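/- Let $\Omega\subset\mathbb R^2$ be a smooth bounded simply connected domain and let $g_1,\dots,g_n:\partial\Omega\to S^1=\{z\in\mathbb C:|z|=1\}$ be smooth maps of degree $d_j=\deg(g_j,\partial\Omega)=0$ for all $j\in\{1,\dots,n\}$. Let $$H^1_{g_j}(\Omega;\mathbb C)=\{u\in H^1(\Omega;\mathbb C):u=g_j\text{ on }\partial\Omega\},\qquad H^1_{g_j}(\Omega;S^1)=\{u\in H^1_{g_j}(\Omega;\mathbb C):|u|=1\text{ a.e. in }\Omega\},$$ with boundary values in the sense of traces, let $$\mathcal X(g_1,\dots,g_n)=\Big\{(u_1,\dots,u_n):u_j\in H^1_{g_j}(\Omega;\mathbb C)\text{ for all }j,\ \sum_{j=1}^n|u_j|^2=n\text{ a.e. in }\Omega\Big\},$$ and set $$I(u_1,\dots,u_n)=\sum_{j=1}^n\int_\Omega|\nabla u_j|^2\,dx,$$ $$\alpha(g_1,\dots,g_n)=\inf\{I(u_1,\dots,u_n):u_j\in H^1_{g_j}(\Omega;S^1)\text{ for all }j\},$$ $$\beta(g_1,\dots,g_n)=\inf\{I(u_1,\dots,u_n):(u_1,\dots,u_n)\in\mathcal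 X(g_1,\dots,g_n)\}.$$ Suppose that $\alpha(g_1,\dots,g_n)=\beta(g_1,\dots,g_n)$ and that this value is attained by $(u_1,\dots,u_n)$ with $u_j\in H^1_{g_j}(\Omega;S^1)$ for all $j$, that is, $I(u_1,\dots,u_n)=\alpha(g_1,\dots,g_n)=\beta(g_1,\dots,g_n)$. Then $|\nabla u_j|=|\nabla u_k|$ a.e. in $\Omega$ for all $j,k\in\{1,\dots,n\}$. -/

import Mathlib

open MeasureTheory Filter Topology Set
open scoped ContDiff ENNReal

noncomputable section

namespace HarmonicMapSystem

/-- The Euclidean plane. -/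
abbrev Plane : Type := EuclideanSpace ℝ (Fin 2)

/-- The unit vector in the direction of the `i`-th coordinate axis. -/
def axis (i : Fin 2) : Plane := EuclideanSpace.single i 1

/-- A smooth bounded simply connected domain in the plane: near each boundary point `Ω` is the
sublevel set `{ρ < 0}` of a smooth function `ρ` which vanishes at that point with `dρ ≠ 0`. -/
structure IsSmoothSimplyConnectedDomain (Ω : Set Plane) : Prop where
  isOpen : IsOpen Ω
  isBounded : Bornology.IsBounded Ω
  isSimplyConnected : IsSimplyConnected Ω
  smooth_boundary : ∀ x ∈ frontier Ω, ∃ U : Set Plane, IsOpen U ∧ x ∈ U ∧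
    ∃ ρ : Plane → ℝ, ContDiffOn ℝ ∞ ρ U ∧ ρ x = 0 ∧ fderiv ℝ ρ x ≠ 0 ∧
      Ω ∩ U = {y ∈ U | ρ y < 0}

/-- `g` restricts to a smooth map from `∂Ω` to the unit circle `S¹ ⊆ ℂ`. Only the values of `g` on
`∂Ω` matter; smoothness on the closed set `∂Ω` means that there is a smooth extension. -/
structure IsSmoothCircleMap (Ω : Set Plane) (g : Plane → ℂ) : Prop where
  smooth : ∃ G : Plane → ℂ, ContDiff ℝ ∞ G ∧ EqOn G g (frontier Ω)
  norm_eq_one : ∀ x ∈ frontier Ω, ‖g x‖ = 1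

/-- Rotation of the plane by a right angle, counterclockwise. -/
def rotate (v : Plane) : Plane := !₂[-(v 1), v 0]

/-- `γ` is a smooth regular `1`-periodic parametrization of the closed curve `∂Ω`, injective on a
period, in the positive direction (`Ω` lies to the left of `γ`). -/
structure IsBoundaryParametrization (Ω : Set Plane) (γ : ℝ → Plane) : Prop where
  smooth : ContDiff ℝ ∞ γ
  periodic : Function.Periodic γ 1
  injOn : InjOn γ (Ico 0 1)
  range_eq : range γ = frontier Ω
  deriv_ne_zero : ∀ t, deriv γ t ≠ 0
  positive : ∀ t, ∀ᶠ s : ℝ in 𝓝[>] 0, γ t + s • rotate (deriv γ t) ∈ Ω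

/-- `deg (g, ∂Ω) = d` for a continuous `g : ∂Ω → S¹`, where `∂Ω` is one smooth closed curve: along a
positively oriented parametrization of `∂Ω`, a continuous argument of `g` grows by `2 π d`.
(The boundary of a smooth bounded simply connected planar domain always has such a
parametrization, and all of them give the same `d`.) -/
def HasDegree (Ω : Set Plane) (g : Plane → ℂ) (d : ℤ) : Prop :=
  ∀ γ : ℝ → Plane, IsBoundaryParametrization Ω γ →
    ∃ θ : ℝ → ℝ, Continuous θ ∧ (∀ t, g (γ t) = Complex.exp (θ t * Complex.I)) ∧
      θ 1 - θ 0 = 2 * Real.pi * d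

/-- `Du` is the weak gradient of `u` on `Ω`. -/
structure HasWeakGradient (Ω : Set Plane) (u : Plane → ℂ) (Du : Plane → EuclideanSpace ℂ (Fin 2)) :
    Prop where
  locallyIntegrableOn : LocallyIntegrableOn u Ω
  locallyIntegrableOn_grad : LocallyIntegrableOn Du Ω
  integral_eq : ∀ φ : Plane → ℝ, ContDiff ℝ ∞ φ → HasCompactSupport φ → tsupport φ ⊆ Ω →
    ∀ i : Fin 2, ∫ x in Ω, fderiv ℝ φ x (axis i) • u x = - ∫ x in Ω, φ x • Du x i

/-- Membership in the Sobolev space `H¹(Ω; ℂ)`. -/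
def MemH1 (Ω : Set Plane) (u : Plane → ℂ) : Prop :=
  MemLp u 2 (volume.restrict Ω) ∧
    ∃ Du : Plane → EuclideanSpace ℂ (Fin 2), MemLp Du 2 (volume.restrict Ω) ∧
      HasWeakGradient Ω u Du

open Classical in
/-- The weak gradient `∇u` of `u` on `Ω` (unique almost everywhere in `Ω` if it exists); its
Euclidean norm is `|∇u| = (|∂₁u|² + |∂₂u|²)^(1/2)`. -/
def weakGradient (Ω : Set Plane) (u : Plane → ℂ) : Plane → EuclideanSpace ℂ (Fin 2) :=
  if h : ∃ Du, HasWeakGradient Ω u Du then h.choose else 0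

/-- The classical gradient of a differentiable function. -/
def classicalGradient (v : Plane → ℂ) (x : Plane) : EuclideanSpace ℂ (Fin 2) :=
  WithLp.toLp 2 fun i => fderiv ℝ v x (axis i)

/-- `u = g` on `∂Ω` in the sense of traces: `g` is the limit in `L²(∂Ω)` (for the arc length, i.e.
the one-dimensional Hausdorff measure) of the boundary values of functions that are smooth up to
the boundary and converge to `u` in `H¹(Ω)`. -/
def HasTrace (Ω : Set Plane) (u g : Plane → ℂ) : Prop :=
  ∃ v : ℕ → Plane → ℂ, (∀ m, ContDiff ℝ ∞ (v m)) ∧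
    Tendsto (fun m => eLpNorm (fun x => v m x - u x) 2 (volume.restrict Ω)) atTop (𝓝 0) ∧
    Tendsto (fun m => eLpNorm (fun x => classicalGradient (v m) x - weakGradient Ω u x) 2
      (volume.restrict Ω)) atTop (𝓝 0) ∧
    Tendsto (fun m => eLpNorm (fun x => v m x - g x) 2
      ((Measure.hausdorffMeasure 1 : Measure Plane).restrict (frontier Ω))) atTop (𝓝 0)

/-- `H¹_g(Ω; ℂ) = {u ∈ H¹(Ω; ℂ) : u = g on ∂Ω}`. -/
def H1 (Ω : Set Plane) (g : Plane → ℂ) : Set (Plane → ℂ) :=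
  {u | MemH1 Ω u ∧ HasTrace Ω u g}

/-- `H¹_g(Ω; S¹)`. -/
def H1Circle (Ω : Set Plane) (g : Plane → ℂ) : Set (Plane → ℂ) :=
  {u | u ∈ H1 Ω g ∧ ∀ᵐ x ∂(volume.restrict Ω), ‖u x‖ = 1}

/-- The class `𝒳(g₁, …, gₙ)` of all `(u₁, …, uₙ)` with `u_j ∈ H¹_{g_j}(Ω; ℂ)` and
`∑ |u_j|² = n` almost everywhere on `Ω`. -/
def admissible {n : ℕ} (Ω : Set Plane) (g : Fin n → Plane → ℂ) : Set (Fin n → Plane → ℂ) :=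
  {u | (∀ j, u j ∈ H1 Ω (g j)) ∧ ∀ᵐ x ∂(volume.restrict Ω), ∑ j, ‖u j x‖ ^ 2 = (n : ℝ)}

/-- The Dirichlet energy `I(u₁, …, uₙ) = ∑ ∫_Ω |∇u_j|²`. -/
def energy {n : ℕ} (Ω : Set Plane) (u : Fin n → Plane → ℂ) : ℝ :=
  ∑ j, ∫ x in Ω, ‖weakGradient Ω (u j) x‖ ^ 2

/-- `α(g₁, …, gₙ) = inf {I(u₁, …, uₙ) : u_j ∈ H¹_{g_j}(Ω; S¹)}`. -/
def alpha {n : ℕ} (Ω : Set Plane) (g : Fin n → Plane → ℂ) : ℝ :=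
  sInf (energy Ω '' {u | ∀ j, u j ∈ H1Circle Ω (g j)})

/-- `β(g₁, …, gₙ) = inf {I(u₁, …, uₙ) : (u₁, …, uₙ) ∈ 𝒳(g₁, …, gₙ)}`. -/
def beta {n : ℕ} (Ω : Set Plane) (g : Fin n → Plane → ℂ) : ℝ :=
  sInf (energy Ω '' admissible Ω g)

end HarmonicMapSystem

end

open MeasureTheory Filter Topology Set
open scoped ContDiff ENNReal

/-! Since α = β, the circle-valued minimizer `u` also minimizes the energy in the larger class 𝒳,
where the individual moduli may vary as long as ∑ |u_j|² = n. Take test functions ψ_j supported in Ω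
with ∑ ψ_j = 0 and compete with √(1 + s ψ_j) u_j: the squared moduli still sum to n and the boundary
values are unchanged.

Because |u_j| = 1, each u_j is orthogonal to its partial derivatives
(`ae_inner_weakGradient_eq_zero`), so |∇(a u_j)|² = a² |∇u_j|² + |∇a|² for real a. With a² = 1 + s
ψ_j the first term is affine in s, and the second is O(s²). Minimality for small s of both signs
therefore gives ∑ ∫ ψ_j |∇u_j|² = 0 (`sum_setIntegral_mul_norm_sq_weakGradient_eq_zero`). Choosing
ψ_j = φ, ψ_k = -φ and all others zero, the fundamental lemma of the calculus of variations yields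
|∇u_j|² = |∇u_k|² a.e. -/

namespace HarmonicMapSystem

/-! ### Convergence in Lᵖ -/

section Lp

variable {α E F : Type*} [MeasurableSpace α] {μ : Measure α}
  [NormedAddCommGroup E] [NormedAddCommGroup F]

theorem tendsto_eLpNorm_zero_of_le_mul {f : ℕ → α → E} {g : ℕ → α → F} {p : ℝ≥0∞} (C : ℝ)
    (h : ∀ m, ∀ᵐ x ∂μ, ‖f m x‖ ≤ C * ‖g m x‖)
    (hg : Tendsto (fun m => eLpNorm (g m) p μ) atTop (𝓝 0)) :
    Tendsto (fun m => eLpNorm (f m) p μ) atTop (𝓝 0) := by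
  have h0 : Tendsto (fun m => ENNReal.ofReal C * eLpNorm (g m) p μ) atTop (𝓝 0) := by
    simpa using ENNReal.Tendsto.const_mul hg (Or.inr ENNReal.ofReal_ne_top)
  exact tendsto_of_tendsto_of_tendsto_of_le_of_le tendsto_const_nhds h0 (fun _ => zero_le)
    fun m => eLpNorm_le_mul_eLpNorm_of_ae_le_mul (h m) p

theorem tendsto_integral_inner_of_eLpNorm [InnerProductSpace ℝ E] {f g : ℕ → α → E} {f₀ g₀ : α → E}
    (hf : ∀ m, MemLp (f m) 2 μ) (hg : ∀ m, MemLp (g m) 2 μ) (hf₀ : MemLp f₀ 2 μ)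
    (hg₀ : MemLp g₀ 2 μ)
    (hfl : Tendsto (fun m => eLpNorm (fun x => f m x - f₀ x) 2 μ) atTop (𝓝 0))
    (hgl : Tendsto (fun m => eLpNorm (fun x => g m x - g₀ x) 2 μ) atTop (𝓝 0)) :
    Tendsto (fun m => ∫ x, inner ℝ (f m x) (g m x) ∂μ) atTop
      (𝓝 (∫ x, inner ℝ (f₀ x) (g₀ x) ∂μ)) := by
  have key : ∀ {a b : α → E} (ha : MemLp a 2 μ) (hb : MemLp b 2 μ),
      inner ℝ (ha.toLp a) (hb.toLp b) = ∫ x, inner ℝ (a x) (b x) ∂μ := by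
    intro a b ha hb
    rw [L2.inner_def]
    refine integral_congr_ae ?_
    filter_upwards [ha.coeFn_toLp, hb.coeFn_toLp] with x h1 h2
    rw [h1, h2]
  have := ((Lp.tendsto_Lp_iff_tendsto_eLpNorm'' f hf f₀ hf₀).2 hfl).inner
    (𝕜 := ℝ) ((Lp.tendsto_Lp_iff_tendsto_eLpNorm'' g hg g₀ hg₀).2 hgl)
  simpa only [key] using this

end Lp

/-- The polynomial has a local minimum at 0, so its derivative there, `A`, vanishes; the sign of `B`
plays no role. -/
theorem eq_zero_of_nonneg_linear_add_sq {A B r : ℝ} (hr : 0 < r)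
    (h : ∀ s, |s| ≤ r → 0 ≤ s * A + s ^ 2 * B) : A = 0 := by
  have hd : HasDerivAt (fun s : ℝ => s * A + s ^ 2 * B) A 0 := by
    exact (((hasDerivAt_id (0 : ℝ)).mul_const A).add
      (((hasDerivAt_id (0 : ℝ)).pow 2).mul_const B)).congr_deriv (by simp)
  refine IsLocalMin.hasDerivAt_eq_zero ?_ hd
  filter_upwards [Metric.closedBall_mem_nhds (0 : ℝ) hr] with s hs
  simpa using h s (by simpa using hs)

variable {Ω : Set Plane}

/-! ### Test functions and smooth multipliers on Ω -/

theorem integrableOn_smul_of_tsupport_subset {E : Type*} [NormedAddCommGroup E] [NormedSpace ℝ E]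
    {f : Plane → ℝ} {u : Plane → E} (hf : Continuous f) (hc : HasCompactSupport f)
    (hs : tsupport f ⊆ Ω) (hu : LocallyIntegrableOn u Ω) :
    IntegrableOn (fun x => f x • u x) Ω := by
  have h : IntegrableOn (fun x => f x • u x) (tsupport f) :=
    (hu.integrableOn_compact_subset hs hc).continuousOn_smul hf.continuousOn hc
  refine ((integrableOn_iff_integrable_of_support_subset ?_).1 h).integrableOn
  exact (Function.support_smul_subset_left f u).trans (subset_tsupport f)

theorem ae_eq_zero_of_setIntegral_contDiff_smul {E : Type*} [NormedAddCommGroup E]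
    [NormedSpace ℝ E] [CompleteSpace E] {f : Plane → E} (hΩ : IsOpen Ω)
    (hf : LocallyIntegrableOn f Ω)
    (h : ∀ φ : Plane → ℝ, ContDiff ℝ ∞ φ → HasCompactSupport φ → tsupport φ ⊆ Ω →
      ∫ x in Ω, φ x • f x = 0) :
    ∀ᵐ x ∂(volume.restrict Ω), f x = 0 := by
  rw [ae_restrict_iff' hΩ.measurableSet]
  refine hΩ.ae_eq_zero_of_integral_contDiff_smul_eq_zero hf fun φ h1 h2 h3 => ?_
  rw [← setIntegral_eq_integral_of_forall_compl_eq_zero (s := Ω)]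
  · exact h φ h1 h2 h3
  · intro x hx
    rw [image_eq_zero_of_notMem_tsupport fun hx' => hx (h3 hx'), zero_smul]

theorem exists_norm_le_of_continuous {E : Type*} [NormedAddCommGroup E] {f : Plane → E}
    (hb : Bornology.IsBounded Ω) (hf : Continuous f) : ∃ C, ∀ x ∈ Ω, ‖f x‖ ≤ C := by
  obtain ⟨C, hC⟩ := hb.isCompact_closure.exists_bound_of_continuousOn hf.continuousOn
  exact ⟨C, fun x hx => hC x (subset_closure hx)⟩

theorem memLp_of_continuous {E : Type*} [NormedAddCommGroup E] {f : Plane → E} {p : ℝ≥0∞}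
    (hΩ : IsOpen Ω) (hb : Bornology.IsBounded Ω) (hf : Continuous f) :
    MemLp f p (volume.restrict Ω) := by
  obtain ⟨C, hC⟩ := exists_norm_le_of_continuous hb hf
  have : IsFiniteMeasure (volume.restrict Ω) := ⟨by simpa using hb.measure_lt_top⟩
  exact MemLp.of_bound hf.aestronglyMeasurable C (ae_restrict_of_forall_mem hΩ.measurableSet hC)

theorem memLp_smul_of_continuous {E : Type*} [NormedAddCommGroup E] [NormedSpace ℝ E]
    {a : Plane → ℝ} {f : Plane → E} {p : ℝ≥0∞}
    (hΩ : IsOpen Ω) (hb : Bornology.IsBounded Ω) (ha : Continuous a)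
    (hf : MemLp f p (volume.restrict Ω)) :
    MemLp (fun x => a x • f x) p (volume.restrict Ω) := by
  obtain ⟨C, hC⟩ := exists_norm_le_of_continuous hb ha
  refine hf.of_le_mul (c := C) (ha.aestronglyMeasurable.smul hf.1) ?_
  filter_upwards [ae_restrict_mem hΩ.measurableSet] with x hx
  rw [norm_smul]
  exact mul_le_mul_of_nonneg_right (hC x hx) (norm_nonneg _)

theorem continuous_fderiv_axis {E : Type*} [NormedAddCommGroup E] [NormedSpace ℝ E]
    {v : Plane → E} (hv : ContDiff ℝ ∞ v) (i : Fin 2) :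
    Continuous fun x => fderiv ℝ v x (axis i) :=
  (hv.continuous_fderiv (by simp)).clm_apply continuous_const

theorem continuous_classicalGradient {v : Plane → ℂ} (hv : ContDiff ℝ ∞ v) :
    Continuous (classicalGradient v) :=
  (PiLp.continuous_toLp 2 _).comp (continuous_pi fun i => continuous_fderiv_axis hv i)

/-- The gradient of a real function, with complex entries. -/
noncomputable def realGradient (a : Plane → ℝ) (x : Plane) : EuclideanSpace ℂ (Fin 2) :=
  WithLp.toLp 2 fun i => ((fderiv ℝ a x (axis i) : ℝ) : ℂ)

theorem continuous_realGradient {a : Plane → ℝ} (ha : ContDiff ℝ ∞ a) :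
    Continuous (realGradient a) :=
  (PiLp.continuous_toLp 2 _).comp
    (continuous_pi fun i => Complex.continuous_ofReal.comp (continuous_fderiv_axis ha i))

theorem classicalGradient_smul {a : Plane → ℝ} {v : Plane → ℂ} (ha : ContDiff ℝ ∞ a)
    (hv : ContDiff ℝ ∞ v) (x : Plane) :
    classicalGradient (fun y => a y • v y) x =
      a x • classicalGradient v x + v x • realGradient a x := by
  ext i
  have h := fderiv_fun_smul (ha.differentiable (by simp) x) (hv.differentiable (by simp) x)
  simp only [classicalGradient, h]
  simp only [realGradient, PiLp.add_apply, PiLp.smul_apply, smul_eq_mul,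
    _root_.add_apply, _root_.smul_apply, ContinuousLinearMap.smulRight_apply, Complex.real_smul]
  ring

/-! ### Weak gradients: uniqueness and the product rule -/

theorem HasWeakGradient.weakGradient {u : Plane → ℂ} {Du : Plane → EuclideanSpace ℂ (Fin 2)}
    (h : HasWeakGradient Ω u Du) : HasWeakGradient Ω u (weakGradient Ω u) := by
  have h' : ∃ Du, HasWeakGradient Ω u Du := ⟨Du, h⟩
  rw [HarmonicMapSystem.weakGradient, dif_pos h']
  exact h'.choose_spec

theorem locallyIntegrableOn_apply {D : Plane → EuclideanSpace ℂ (Fin 2)}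
    (h : LocallyIntegrableOn D Ω) (i : Fin 2) : LocallyIntegrableOn (fun x => D x i) Ω := by
  intro x hx
  obtain ⟨s, hs, hi⟩ := h x hx
  exact ⟨s, hs, (EuclideanSpace.proj (𝕜 := ℂ) i).integrable_comp hi⟩

/-- `weakGradient` is an arbitrary choice; uniqueness allows replacing it by any explicit weak
gradient, such as the one from the product rule. -/
theorem HasWeakGradient.ae_eq {u : Plane → ℂ} {D₁ D₂ : Plane → EuclideanSpace ℂ (Fin 2)}
    (hΩ : IsOpen Ω) (h₁ : HasWeakGradient Ω u D₁) (h₂ : HasWeakGradient Ω u D₂) :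
    D₁ =ᵐ[volume.restrict Ω] D₂ := by
  have key : ∀ i, ∀ᵐ x ∂(volume.restrict Ω), D₁ x i - D₂ x i = 0 := by
    intro i
    have l₁ := locallyIntegrableOn_apply h₁.locallyIntegrableOn_grad i
    have l₂ := locallyIntegrableOn_apply h₂.locallyIntegrableOn_grad i
    refine ae_eq_zero_of_setIntegral_contDiff_smul hΩ (l₁.sub l₂) fun φ s c t => ?_
    have e := (h₁.integral_eq φ s c t i).symm.trans (h₂.integral_eq φ s c t i)
    simp only [smul_sub]
    rw [integral_sub (integrableOn_smul_of_tsupport_subset s.continuous c t l₁)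
      (integrableOn_smul_of_tsupport_subset s.continuous c t l₂), neg_inj.1 e, sub_self]
  filter_upwards [ae_all_iff.2 key] with x hx
  ext i
  exact sub_eq_zero.1 (hx i)

theorem HasWeakGradient.smul {u : Plane → ℂ} {D : Plane → EuclideanSpace ℂ (Fin 2)}
    {a : Plane → ℝ} (hΩ : IsOpen Ω) (h : HasWeakGradient Ω u D) (ha : ContDiff ℝ ∞ a) :
    HasWeakGradient Ω (fun x => a x • u x) (fun x => a x • D x + u x • realGradient a x) := by
  have hl := hΩ.isLocallyClosed
  refine ⟨h.locallyIntegrableOn.continuousOn_smul hl ha.continuous.continuousOn,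
    (h.locallyIntegrableOn_grad.continuousOn_smul hl ha.continuous.continuousOn).add
      (h.locallyIntegrableOn.smul_continuousOn hl (continuous_realGradient ha).continuousOn), ?_⟩
  intro φ s c t i
  have l := locallyIntegrableOn_apply h.locallyIntegrableOn_grad i
  have cφ : HasCompactSupport (fun x => fderiv ℝ φ x (axis i)) := c.fderiv_apply (𝕜 := ℝ) _
  have tφ : tsupport (fun x => fderiv ℝ φ x (axis i)) ⊆ Ω :=
    (tsupport_fderiv_apply_subset ℝ _).trans t
  have i₁ := integrableOn_smul_of_tsupport_subset
    (f := fun x => fderiv ℝ φ x (axis i) * a x) ((continuous_fderiv_axis s i).mul ha.continuous)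
    cφ.mul_right ((tsupport_mul_subset_left).trans tφ) h.locallyIntegrableOn
  have i₂ := integrableOn_smul_of_tsupport_subset
    (f := fun x => φ x * fderiv ℝ a x (axis i)) (s.continuous.mul (continuous_fderiv_axis ha i))
    c.mul_right ((tsupport_mul_subset_left).trans t) h.locallyIntegrableOn
  have i₃ := integrableOn_smul_of_tsupport_subset (f := fun x => φ x * a x) (s.continuous.mul ha.continuous)
    c.mul_right ((tsupport_mul_subset_left).trans t) l
  -- The product rule for `a u` tested against `φ` comes from testing `u` against `φ a`.
  have e := h.integral_eq (fun x => φ x * a x) (s.mul ha) c.mul_right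
    ((tsupport_mul_subset_left).trans t) i
  have e₁ : ∀ x, fderiv ℝ (fun x => φ x * a x) x (axis i) • u x =
      (fderiv ℝ φ x (axis i) * a x) • u x + (φ x * fderiv ℝ a x (axis i)) • u x := by
    intro x
    rw [fderiv_fun_mul (s.differentiable (by simp) x) (ha.differentiable (by simp) x), ← add_smul]
    simp only [_root_.add_apply, _root_.smul_apply, smul_eq_mul]
    ring_nf
  simp only [e₁] at e
  rw [integral_add i₁ i₂] at e
  have e₂ : ∀ x, φ x • (a x • D x + u x • realGradient a x) i =
      (φ x * a x) • D x i + (φ x * fderiv ℝ a x (axis i)) • u x := by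
    intro x
    simp only [realGradient, PiLp.add_apply, PiLp.smul_apply, smul_eq_mul, Complex.real_smul,
      Complex.ofReal_mul]
    ring
  simp only [e₂, smul_smul]
  rw [integral_add i₃ i₂, neg_add, ← e]
  abel

theorem MemH1.hasWeakGradient {u : Plane → ℂ} (h : MemH1 Ω u) :
    HasWeakGradient Ω u (weakGradient Ω u) :=
  h.2.choose_spec.2.weakGradient

theorem MemH1.memLp_weakGradient {u : Plane → ℂ} (hΩ : IsOpen Ω) (h : MemH1 Ω u) :
    MemLp (weakGradient Ω u) 2 (volume.restrict Ω) :=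
  h.2.choose_spec.1.ae_eq (h.2.choose_spec.2.ae_eq hΩ h.hasWeakGradient)

theorem MemH1.weakGradient_smul {u : Plane → ℂ} {a : Plane → ℝ} (hΩ : IsOpen Ω) (h : MemH1 Ω u)
    (ha : ContDiff ℝ ∞ a) :
    weakGradient Ω (fun x => a x • u x) =ᵐ[volume.restrict Ω]
      fun x => a x • weakGradient Ω u x + u x • realGradient a x :=
  (h.hasWeakGradient.smul hΩ ha).weakGradient.ae_eq hΩ (h.hasWeakGradient.smul hΩ ha)

theorem memLp_smul_realGradient {u : Plane → ℂ} {a : Plane → ℝ} {p : ℝ≥0∞} (hΩ : IsOpen Ω)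
    (hb : Bornology.IsBounded Ω) (hu : MemLp u p (volume.restrict Ω)) (ha : ContDiff ℝ ∞ a) :
    MemLp (fun x => u x • realGradient a x) p (volume.restrict Ω) := by
  obtain ⟨C, hC⟩ := exists_norm_le_of_continuous hb (continuous_realGradient ha)
  refine hu.of_le_mul (c := C)
    (hu.1.smul (continuous_realGradient ha).aestronglyMeasurable) ?_
  filter_upwards [ae_restrict_mem hΩ.measurableSet] with x hx
  rw [norm_smul, mul_comm]
  exact mul_le_mul_of_nonneg_right (hC x hx) (norm_nonneg _)

theorem MemH1.smul {u : Plane → ℂ} {a : Plane → ℝ} (hΩ : IsOpen Ω) (hb : Bornology.IsBounded Ω)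
    (h : MemH1 Ω u) (ha : ContDiff ℝ ∞ a) : MemH1 Ω (fun x => a x • u x) :=
  ⟨memLp_smul_of_continuous hΩ hb ha.continuous h.1, _,
    (memLp_smul_of_continuous hΩ hb ha.continuous (h.memLp_weakGradient hΩ)).add
      (memLp_smul_realGradient hΩ hb h.1 ha), h.hasWeakGradient.smul hΩ ha⟩

/-- If the `v m` approximate `u`, then the `a v m` approximate `a u`: the gradient error is a (∇v_m
- ∇u) + (v_m - u) ∇a, with `a` and ∇a bounded on Ω. On the boundary `a = 1`, so nothing changes
there. -/
theorem HasTrace.smul {u g : Plane → ℂ} {a : Plane → ℝ} (hΩ : IsOpen Ω)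
    (hb : Bornology.IsBounded Ω) (hu : MemH1 Ω u) (h : HasTrace Ω u g) (ha : ContDiff ℝ ∞ a)
    (ha₁ : ∀ x ∈ frontier Ω, a x = 1) : HasTrace Ω (fun x => a x • u x) g := by
  obtain ⟨v, vs, h₀, h₁, h₂⟩ := h
  obtain ⟨C, hC⟩ := exists_norm_le_of_continuous hb ha.continuous
  obtain ⟨K, hK⟩ := exists_norm_le_of_continuous hb (continuous_realGradient ha)
  refine ⟨fun m x => a x • v m x, fun m => ha.smul (vs m), ?_, ?_, ?_⟩
  · refine tendsto_eLpNorm_zero_of_le_mul C (fun m => ?_) h₀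
    filter_upwards [ae_restrict_mem hΩ.measurableSet] with x hx
    rw [← smul_sub, norm_smul]
    exact mul_le_mul_of_nonneg_right (hC x hx) (norm_nonneg _)
  · have t₁ : Tendsto (fun m => eLpNorm (fun x => a x • (classicalGradient (v m) x -
        weakGradient Ω u x)) 2 (volume.restrict Ω)) atTop (𝓝 0) := by
      refine tendsto_eLpNorm_zero_of_le_mul C (fun m => ?_) h₁
      filter_upwards [ae_restrict_mem hΩ.measurableSet] with x hx
      rw [norm_smul]
      exact mul_le_mul_of_nonneg_right (hC x hx) (norm_nonneg _)
    have t₂ : Tendsto (fun m => eLpNorm (fun x => (v m x - u x) • realGradient a x) 2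
        (volume.restrict Ω)) atTop (𝓝 0) := by
      refine tendsto_eLpNorm_zero_of_le_mul K (fun m => ?_) h₀
      filter_upwards [ae_restrict_mem hΩ.measurableSet] with x hx
      rw [norm_smul, mul_comm]
      exact mul_le_mul_of_nonneg_right (hK x hx) (norm_nonneg _)
    have t₃ := t₁.add t₂
    rw [add_zero] at t₃
    refine tendsto_of_tendsto_of_tendsto_of_le_of_le tendsto_const_nhds t₃
      (fun _ => zero_le) fun m => ?_
    have hsum := eLpNorm_add_le (p := 2) (μ := volume.restrict Ω)
      (f := fun x => a x • (classicalGradient (v m) x - weakGradient Ω u x))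
      (g := fun x => (v m x - u x) • realGradient a x)
      (ha.continuous.aestronglyMeasurable.smul
        ((continuous_classicalGradient (vs m)).aestronglyMeasurable.sub
          (hu.memLp_weakGradient hΩ).1))
      (((vs m).continuous.aestronglyMeasurable.sub hu.1.1).smul
        (continuous_realGradient ha).aestronglyMeasurable) (by norm_num)
    refine (eLpNorm_congr_ae ?_).trans_le hsum
    filter_upwards [hu.weakGradient_smul hΩ ha] with x hx
    rw [hx, classicalGradient_smul ha (vs m)]
    simp only [Pi.add_apply, smul_sub, sub_smul]
    abel
  · refine (tendsto_congr fun m => eLpNorm_congr_ae ?_).2 h₂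
    filter_upwards [ae_restrict_mem isClosed_frontier.measurableSet] with x hx
    rw [ha₁ x hx, one_smul]

/-! ### Orthogonality of a circle-valued map to its derivatives -/

/-- Integration by parts applied to ‖v‖², whose derivative is 2⟨v, ∂ᵢv⟩. Both sides are L² pairings,
so the identity survives H¹ limits. -/
theorem setIntegral_inner_fderiv_eq_neg {φ : Plane → ℝ} {v : Plane → ℂ} (hφ : ContDiff ℝ ∞ φ)
    (hc : HasCompactSupport φ) (ht : tsupport φ ⊆ Ω) (hv : ContDiff ℝ ∞ v) (i : Fin 2) :
    2 * ∫ x in Ω, inner ℝ (φ x • v x) (fderiv ℝ v x (axis i)) =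
      -∫ x in Ω, inner ℝ (fderiv ℝ φ x (axis i) • v x) (v x) := by
  have hd : ∀ x, fderiv ℝ (fun y => ‖v y‖ ^ 2) x (axis i) =
      2 * inner ℝ (v x) (fderiv ℝ v x (axis i)) := by
    intro x
    have := (hv.differentiable (by simp) x).hasFDerivAt.norm_sq
    rw [this.fderiv, _root_.smul_apply, ContinuousLinearMap.comp_apply, innerSL_apply_apply,
      nsmul_eq_mul, Nat.cast_ofNat]
  have hn : ContDiff ℝ ∞ fun y => ‖v y‖ ^ 2 := hv.norm_sq ℝ
  have cφ : HasCompactSupport (fun x => fderiv ℝ φ x (axis i)) := hc.fderiv_apply (𝕜 := ℝ) _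
  have key := integral_mul_fderiv_eq_neg_fderiv_mul_of_integrable (μ := (volume : Measure Plane))
    (f := φ) (g := fun y => ‖v y‖ ^ 2) (v := axis i)
    (((continuous_fderiv_axis hφ i).mul hn.continuous).integrable_of_hasCompactSupport
      cφ.mul_right)
    ((hφ.continuous.mul (continuous_fderiv_axis hn i)).integrable_of_hasCompactSupport
      hc.mul_right)
    ((hφ.continuous.mul hn.continuous).integrable_of_hasCompactSupport hc.mul_right)
    (fun x _ => hφ.differentiable (by simp) x) (fun x _ => hn.differentiable (by simp) x)
  rw [← setIntegral_eq_integral_of_forall_compl_eq_zero (s := Ω)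
      (f := fun x => φ x * fderiv ℝ (fun y => ‖v y‖ ^ 2) x (axis i)),
    ← setIntegral_eq_integral_of_forall_compl_eq_zero (s := Ω)
      (f := fun x => fderiv ℝ φ x (axis i) * ‖v x‖ ^ 2)] at key
  · rw [← integral_const_mul]
    simp only [real_inner_smul_left, hd, real_inner_self_eq_norm_sq] at key ⊢
    rw [← key]
    congr 1 with x
    ring
  · intro x hx
    rw [image_eq_zero_of_notMem_tsupport fun h =>
      hx (ht ((tsupport_fderiv_apply_subset ℝ (axis i)) h)), zero_mul]
  · intro x hx
    rw [image_eq_zero_of_notMem_tsupport fun h => hx (ht h), zero_mul]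

theorem setIntegral_fderiv_axis_eq_zero {φ : Plane → ℝ} (hφ : ContDiff ℝ ∞ φ)
    (hc : HasCompactSupport φ) (ht : tsupport φ ⊆ Ω) (i : Fin 2) :
    ∫ x in Ω, fderiv ℝ φ x (axis i) = 0 := by
  have := setIntegral_inner_fderiv_eq_neg hφ hc ht (contDiff_const (c := (1 : ℂ))) i
  simpa [inner_smul_left] using this

/-- A Sobolev map with values in the unit circle is orthogonal to its derivatives. -/
theorem ae_inner_weakGradient_eq_zero {u g : Plane → ℂ} (hΩ : IsOpen Ω)
    (hb : Bornology.IsBounded Ω) (hu : u ∈ H1Circle Ω g) (i : Fin 2) :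
    ∀ᵐ x ∂(volume.restrict Ω), inner ℝ (u x) (weakGradient Ω u x i) = 0 := by
  obtain ⟨⟨hm, v, vs, h₀, h₁, -⟩, hn⟩ := hu
  have mD : MemLp (fun x => weakGradient Ω u x i) 2 (volume.restrict Ω) :=
    (EuclideanSpace.proj (𝕜 := ℂ) i).comp_memLp' (hm.memLp_weakGradient hΩ)
  have hint : Integrable (fun x => inner ℝ (u x) (weakGradient Ω u x i)) (volume.restrict Ω) :=
    memLp_one_iff_integrable.1 <| MemLp.of_bilin (p := 2) (q := 2) (fun z w : ℂ => inner ℝ z w) 1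
      hm.1 mD (hm.1.1.inner mD.1) (.of_forall fun x => by
        simpa only [NNReal.coe_one, one_mul] using
          nnnorm_inner_le_nnnorm (𝕜 := ℝ) (u x) (weakGradient Ω u x i))
  refine ae_eq_zero_of_setIntegral_contDiff_smul hΩ
    (IntegrableOn.locallyIntegrableOn hint) fun φ s c t => ?_
  have smul_lim : ∀ b : Plane → ℝ, Continuous b →
      Tendsto (fun m => eLpNorm (fun x => b x • v m x - b x • u x) 2 (volume.restrict Ω))
        atTop (𝓝 0) := by
    intro b hbc
    obtain ⟨C, hC⟩ := exists_norm_le_of_continuous hb hbc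
    refine tendsto_eLpNorm_zero_of_le_mul C (fun m => ?_) h₀
    filter_upwards [ae_restrict_mem hΩ.measurableSet] with x hx
    rw [← smul_sub, norm_smul]
    exact mul_le_mul_of_nonneg_right (hC x hx) (norm_nonneg _)
  have grad_lim : Tendsto (fun m => eLpNorm (fun x => fderiv ℝ (v m) x (axis i) -
      weakGradient Ω u x i) 2 (volume.restrict Ω)) atTop (𝓝 0) := by
    refine tendsto_eLpNorm_zero_of_le_mul 1 (fun m => ?_) h₁
    refine Eventually.of_forall fun x => ?_
    rw [one_mul]
    exact PiLp.norm_apply_le (classicalGradient (v m) x - weakGradient Ω u x) i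
  have dφ := continuous_fderiv_axis s i
  -- The smooth functions supplied by `HasTrace` converge to `u` in H¹, so both sides of the smooth
  -- identity pass to the limit.
  have t₁ := tendsto_integral_inner_of_eLpNorm
    (fun m => memLp_of_continuous hΩ hb (s.continuous.smul (vs m).continuous))
    (fun m => memLp_of_continuous hΩ hb (continuous_fderiv_axis (vs m) i))
    (memLp_smul_of_continuous hΩ hb s.continuous hm.1) mD (smul_lim φ s.continuous) grad_lim
  have t₂ := tendsto_integral_inner_of_eLpNorm
    (fun m => memLp_of_continuous hΩ hb (dφ.smul (vs m).continuous))
    (fun m => memLp_of_continuous hΩ hb (vs m).continuous)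
    (memLp_smul_of_continuous hΩ hb dφ hm.1) hm.1 (smul_lim _ dφ) h₀
  have e := tendsto_nhds_unique (t₁.const_mul 2)
    (t₂.neg.congr fun m => (setIntegral_inner_fderiv_eq_neg s c t (vs m) i).symm)
  -- Here |u| = 1 enters: the right-hand side reduces to the integral of ∂ᵢφ.
  have z : ∫ x in Ω, inner ℝ (fderiv ℝ φ x (axis i) • u x) (u x) = 0 := by
    rw [← setIntegral_fderiv_axis_eq_zero s c t i]
    refine integral_congr_ae ?_
    filter_upwards [hn] with x hx
    rw [real_inner_smul_left, real_inner_self_eq_norm_sq, hx, one_pow, mul_one]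
  rw [z, neg_zero] at e
  simpa only [real_inner_smul_left, smul_eq_mul, mul_eq_zero, OfNat.ofNat_ne_zero, false_or] using e

/-! ### Energy under a change of modulus, and the first variation -/

/-- In each coordinate the second summand is a real multiple of `z`, hence orthogonal to `D i`, and
Pythagoras applies. -/
theorem norm_sq_smul_add_smul_realGradient {a : Plane → ℝ} {x : Plane} {z : ℂ}
    {D : EuclideanSpace ℂ (Fin 2)} (hz : ‖z‖ = 1) (hD : ∀ i, inner ℝ z (D i) = 0) :
    ‖a x • D + z • realGradient a x‖ ^ 2 = a x ^ 2 * ‖D‖ ^ 2 + ‖realGradient a x‖ ^ 2 := by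
  simp only [EuclideanSpace.norm_sq_eq, Finset.mul_sum, ← Finset.sum_add_distrib]
  refine Finset.sum_congr rfl fun i _ => ?_
  have e : (a x • D + z • realGradient a x) i =
      a x • D i + (fderiv ℝ a x (axis i)) • z := by
    simp [realGradient, mul_comm]
  rw [e, norm_add_sq_real, inner_smul_left, inner_smul_right, real_inner_comm, hD i, norm_smul,
    norm_smul, hz]
  simp [realGradient, mul_pow]

theorem setIntegral_norm_sq_weakGradient_smul {u g : Plane → ℂ} {a : Plane → ℝ} (hΩ : IsOpen Ω)
    (hb : Bornology.IsBounded Ω) (hu : u ∈ H1Circle Ω g) (ha : ContDiff ℝ ∞ a) :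
    ∫ x in Ω, ‖weakGradient Ω (fun y => a y • u y) x‖ ^ 2 =
      (∫ x in Ω, a x ^ 2 * ‖weakGradient Ω u x‖ ^ 2) + ∫ x in Ω, ‖realGradient a x‖ ^ 2 := by
  have hm := hu.1.1
  rw [← integral_add]
  · refine integral_congr_ae ?_
    filter_upwards [hm.weakGradient_smul hΩ ha, hu.2,
      ae_all_iff.2 (ae_inner_weakGradient_eq_zero hΩ hb hu)] with x h₁ h₂ h₃
    rw [h₁, norm_sq_smul_add_smul_realGradient h₂ h₃]
  · have := (memLp_smul_of_continuous hΩ hb ha.continuous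
      (hm.memLp_weakGradient hΩ)).integrable_norm_pow (p := 2) (by norm_num)
    simpa [norm_smul, mul_pow] using this
  · exact (memLp_of_continuous hΩ hb (continuous_realGradient ha)).integrable_norm_pow
      (p := 2) (by norm_num)

theorem norm_sq_realGradient_sqrt_le {ψ : Plane → ℝ} {s : ℝ} (hψ : ContDiff ℝ ∞ ψ)
    (h : ∀ x, |s * ψ x| ≤ 1 / 2) (x : Plane) :
    ‖realGradient (fun y => √(1 + s * ψ y)) x‖ ^ 2 ≤ s ^ 2 * ‖realGradient ψ x‖ ^ 2 := by
  have hp : 1 / 2 ≤ 1 + s * ψ x := by linarith [(abs_le.1 (h x)).1]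
  have hd := ((((hψ.differentiable (by simp) x).hasFDerivAt).const_mul s).const_add 1).sqrt
    (by linarith : (1 + s * ψ x) ≠ 0)
  simp only [EuclideanSpace.norm_sq_eq, Finset.mul_sum]
  refine Finset.sum_le_sum fun i _ => ?_
  have hq : 1 / 2 ≤ √(1 + s * ψ x) ^ 2 := by rwa [Real.sq_sqrt (by linarith)]
  simp only [realGradient, hd.fderiv, Complex.norm_real, Real.norm_eq_abs, sq_abs,
    _root_.smul_apply, smul_eq_mul, mul_pow, div_pow]
  -- The derivative of √(1 + sψ) is s ∂ψ / (2√(1 + sψ)), and 4(1 + sψ) ≥ 2.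
  have : (1 / (2 * √(1 + s * ψ x))) ^ 2 ≤ 1 := by
    rw [div_pow, mul_pow, div_le_one (by linarith)]
    linarith
  simp only [mul_pow, div_pow] at this
  exact mul_le_of_le_one_left (by positivity) this

/-- The first variation of the energy of a minimizer with values in the circle, under changes of
the moduli. -/
theorem sum_setIntegral_mul_norm_sq_weakGradient_eq_zero {n : ℕ} {g u : Fin n → Plane → ℂ}
    (hΩ : IsOpen Ω) (hb : Bornology.IsBounded Ω) (hu : ∀ j, u j ∈ H1Circle Ω (g j))
    (hmin : ∀ w ∈ admissible Ω g, energy Ω u ≤ energy Ω w) {ψ : Fin n → Plane → ℝ}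
    (hψ : ∀ j, ContDiff ℝ ∞ (ψ j)) (hc : ∀ j, HasCompactSupport (ψ j))
    (ht : ∀ j, tsupport (ψ j) ⊆ Ω) (h0 : ∀ x, ∑ j, ψ j x = 0) :
    ∑ j, ∫ x in Ω, ψ j x * ‖weakGradient Ω (u j) x‖ ^ 2 = 0 := by
  choose C hC using fun j => (hc j).exists_bound_of_continuous (hψ j).continuous
  -- A common bound for all ψ_j; the summand 1 keeps it positive. For |s| ≤ 1/(2M) every |s ψ_j| is
  -- at most 1/2, so the square roots below are smooth.
  set M : ℝ := 1 + ∑ j, |C j| with hM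
  have hM0 : 0 < M := by positivity
  have hCM : ∀ j x, |ψ j x| ≤ M := fun j x =>
    (hC j x).trans <| (le_abs_self _).trans <|
      (Finset.single_le_sum (f := fun j => |C j|) (fun _ _ => abs_nonneg _)
        (Finset.mem_univ j)).trans (by linarith)
  refine eq_zero_of_nonneg_linear_add_sq (r := 1 / (2 * M))
    (B := ∑ j, ∫ x in Ω, ‖realGradient (ψ j) x‖ ^ 2) (by positivity) fun s hs => ?_
  have hsψ : ∀ j x, |s * ψ j x| ≤ 1 / 2 := by
    intro j x
    rw [abs_mul]
    calc |s| * |ψ j x| ≤ 1 / (2 * M) * M :=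
          mul_le_mul hs (hCM j x) (abs_nonneg _) (by positivity)
      _ = 1 / 2 := by field_simp
  have hpos : ∀ j x, 0 < 1 + s * ψ j x := fun j x => by linarith [(abs_le.1 (hsψ j x)).1]
  set a : Fin n → Plane → ℝ := fun j x => √(1 + s * ψ j x) with ha
  have has : ∀ j, ContDiff ℝ ∞ (a j) := fun j =>
    (contDiff_const.add (contDiff_const.mul (hψ j))).sqrt fun x => (hpos j x).ne'
  have hsq : ∀ j x, a j x ^ 2 = 1 + s * ψ j x := fun j x => Real.sq_sqrt (hpos j x).le
  have ha1 : ∀ j, ∀ x ∈ frontier Ω, a j x = 1 := by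
    intro j x hx
    have : x ∉ tsupport (ψ j) := fun h => by
      rw [hΩ.frontier_eq] at hx
      exact hx.2 (ht j h)
    simp [ha, image_eq_zero_of_notMem_tsupport this]
  have hadm : (fun j x => a j x • u j x) ∈ admissible Ω g := by
    refine ⟨fun j => ⟨(hu j).1.1.smul hΩ hb (has j),
      (hu j).1.2.smul hΩ hb (hu j).1.1 (has j) (ha1 j)⟩, ?_⟩
    filter_upwards [ae_all_iff.2 fun j => (hu j).2] with x hx
    simp only [norm_smul, hx, Real.norm_eq_abs, sq_abs, hsq, mul_one]
    rw [Finset.sum_add_distrib, ← Finset.mul_sum, h0]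
    simp
  have hle := hmin _ hadm
  have gi : ∀ j, IntegrableOn (fun x => ‖weakGradient Ω (u j) x‖ ^ 2) Ω := fun j =>
    ((hu j).1.1.memLp_weakGradient hΩ).integrable_norm_pow (p := 2) (by norm_num)
  -- Summed over `j`, this bounds the competitor's energy by that of `u` plus s A + s² B, so
  -- minimality makes s A + s² B nonnegative.
  have ge : ∀ j, ∫ x in Ω, ‖weakGradient Ω (fun y => a j y • u j y) x‖ ^ 2 ≤
      (∫ x in Ω, ‖weakGradient Ω (u j) x‖ ^ 2) +
      s * (∫ x in Ω, ψ j x * ‖weakGradient Ω (u j) x‖ ^ 2) +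
      s ^ 2 * ∫ x in Ω, ‖realGradient (ψ j) x‖ ^ 2 := by
    intro j
    rw [setIntegral_norm_sq_weakGradient_smul hΩ hb (hu j) (has j), ← integral_const_mul,
      ← integral_const_mul, ← integral_add (gi j)]
    · refine add_le_add (le_of_eq ?_) ?_
      · congr 1 with x
        rw [hsq]
        ring
      · refine integral_mono ?_ ?_ (norm_sq_realGradient_sqrt_le (hψ j) (hsψ j))
        · exact (memLp_of_continuous hΩ hb (continuous_realGradient (has j))).integrable_norm_pow
            (p := 2) (by norm_num)
        · exact ((memLp_of_continuous hΩ hb (continuous_realGradient (hψ j))).integrable_norm_pow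
            (p := 2) (by norm_num)).const_mul _
    · exact (integrableOn_smul_of_tsupport_subset (hψ j).continuous (hc j) (ht j)
        (gi j).locallyIntegrableOn).const_mul s
  have hsum := Finset.sum_le_sum fun j (_ : j ∈ Finset.univ) => ge j
  simp only [Finset.sum_add_distrib, ← Finset.mul_sum] at hsum
  simp only [energy] at hle
  linarith

end HarmonicMapSystem

theorem mainTheorem6 (n : ℕ) (Ω : Set HarmonicMapSystem.Plane)
    (hΩ : HarmonicMapSystem.IsSmoothSimplyConnectedDomain Ω)
    (g : Fin n → HarmonicMapSystem.Plane → ℂ)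
    (hg : ∀ j, HarmonicMapSystem.IsSmoothCircleMap Ω (g j))
    (hdeg : ∀ j, HarmonicMapSystem.HasDegree Ω (g j) 0)
    (hαβ : HarmonicMapSystem.alpha Ω g = HarmonicMapSystem.beta Ω g)
    (u : Fin n → HarmonicMapSystem.Plane → ℂ)
    (hu : ∀ j, u j ∈ HarmonicMapSystem.H1Circle Ω (g j))
    (hmin : HarmonicMapSystem.energy Ω u = HarmonicMapSystem.alpha Ω g) :
    ∀ j k, ∀ᵐ x ∂(MeasureTheory.volume.restrict Ω),
      ‖HarmonicMapSystem.weakGradient Ω (u j) x‖ = ‖HarmonicMapSystem.weakGradient Ω (u k) x‖ := by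
  open HarmonicMapSystem in
  intro j k
  -- This is where α = β is used. The real infimum is a lower bound only for sets bounded below,
  -- here by 0.
  have hle : ∀ w ∈ admissible Ω g, energy Ω u ≤ energy Ω w := by
    intro w hw
    rw [hmin, hαβ]
    refine csInf_le ⟨0, ?_⟩ (mem_image_of_mem _ hw)
    rintro _ ⟨v, -, rfl⟩
    exact Finset.sum_nonneg fun l _ => integral_nonneg fun x => by positivity
  have gi : ∀ l, IntegrableOn (fun x => ‖weakGradient Ω (u l) x‖ ^ 2) Ω := fun l =>
    ((hu l).1.1.memLp_weakGradient hΩ.isOpen).integrable_norm_pow (p := 2) (by norm_num)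
  have key : ∀ᵐ x ∂(volume.restrict Ω),
      ‖weakGradient Ω (u j) x‖ ^ 2 - ‖weakGradient Ω (u k) x‖ ^ 2 = 0 := by
    refine ae_eq_zero_of_setIntegral_contDiff_smul hΩ.isOpen
      ((gi j).locallyIntegrableOn.sub (gi k).locallyIntegrableOn) fun φ s c t => ?_
    -- The weights sum to zero; for `j = k` they all vanish, so this case needs no separate
    -- treatment.
    set ε : Fin n → ℝ := fun l => (if l = j then 1 else 0) - (if l = k then 1 else 0) with hε
    have h := sum_setIntegral_mul_norm_sq_weakGradient_eq_zero hΩ.isOpen hΩ.isBounded hu hle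
      (ψ := fun l x => ε l * φ x) (fun l => contDiff_const.mul s) (fun l => c.mul_left)
      (fun l => (tsupport_mul_subset_right).trans t)
      (fun x => by rw [← Finset.sum_mul]; simp [hε])
    simp only [mul_assoc, integral_const_mul] at h
    simp only [hε, sub_mul, Finset.sum_sub_distrib, ite_mul, one_mul, zero_mul,
      Finset.sum_ite_eq', Finset.mem_univ, if_true] at h
    simp only [smul_eq_mul, mul_sub]
    rw [integral_sub, h]
    · exact integrableOn_smul_of_tsupport_subset s.continuous c t (gi j).locallyIntegrableOn
    · exact integrableOn_smul_of_tsupport_subset s.continuous c t (gi k).locallyIntegrableOn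
  filter_upwards [key] with x hx
  exact (sq_eq_sq₀ (norm_nonneg _) (norm_nonneg _)).1 (sub_eq_zero.1 hx)
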